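/- Let $\zeta$ denote the Riemann zeta function, and for $n\in\{3,4\}$ let $s(n)=\sum_{k=1}^{\infty}\frac{1}{k^{n}}\binom{2k}{k}\frac{1}{4^{k}}$. Both series converge, and $$s(3)=\sum_{k=1}^{\infty}\frac{1}{k^{3}}\binom{2k}{k}\frac{1}{4^{k}}=2\zeta(3)-2\ln(2)\,\zeta(2)+\frac{4}{3}(\ln 2)^{3},$$ $$s(4)=\sum_{k=1}^{\infty}\frac{1}{k^{4}}\binom{2k}{k}\frac{1}{4^{k}}=\frac{9}{4}\zeta(4)-4\ln(2)\,\zeta(3)+2(\ln 2)^{2}\zeta(2)-\frac{2}{3}(\ln 2)^{4}.$$ -/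

import Mathlib

/-!
Put `a k = binom(2k, k) / 4 ^ k`. The function `H z = 1 - z ∑ a k / (k - z)`, summed over `k ≥ 1`,
has the Taylor coefficients `1, -s(1), -s(2), …` at `0`. The recurrence
`(k + 1) a (k + 1) = (k + 1/2) a k` makes a sum telescope and yields the functional equation
`(1 - z) H z = (1/2 - z) H (z - 1)`. Take logarithmic derivatives and iterate towards `-∞`, where
`H' / H` tends to `0`: this gives `H' = H D` with `D z = ∑ (1 / (j + 1 - z) - 1 / (j + 1/2 - z))`,
`j ≥ 0`. The Taylor coefficients of `D` at `0` are `-2 log 2` and `(2 - 2 ^ (n + 1)) ζ(n + 1)` for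
`n ≥ 1`, so comparing coefficients in `H' = H D` determines every `s(n)` recursively. The square
`ζ(2) ^ 2` that enters `s(4)` is `5/2 ζ(4)`.
-/

open Filter Topology Set Finset

section TaylorSequences

variable {𝕜 F A ι : Type*} [NontriviallyNormedField 𝕜] [NormedAddCommGroup F] [NormedSpace 𝕜 F]
  [NormedRing A] [NormedAlgebra 𝕜 A] {s t : Set 𝕜}

variable (𝕜) in
/-- `f n` is the `n`-th Taylor coefficient of `f 0`, as a function of the centre of expansion in
`s`. This is encoded by the derivatives `(f n)' = (n + 1) f (n + 1)`, so that no factorials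
appear. -/
def IsTaylorSeq (f : ℕ → 𝕜 → F) (s : Set 𝕜) : Prop :=
  ∀ n, ∀ z ∈ s, HasDerivAt (f n) ((n + 1 : 𝕜) • f (n + 1) z) z

namespace IsTaylorSeq

theorem mono {f : ℕ → 𝕜 → F} (hf : IsTaylorSeq 𝕜 f s) (hts : t ⊆ s) : IsTaylorSeq 𝕜 f t :=
  fun n z hz => hf n z (hts hz)

theorem sub {f g : ℕ → 𝕜 → F} (hf : IsTaylorSeq 𝕜 f s) (hg : IsTaylorSeq 𝕜 g s) :
    IsTaylorSeq 𝕜 (fun n z => f n z - g n z) s :=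
  fun n z hz => ((hf n z hz).sub (hg n z hz)).congr_deriv (smul_sub _ _ _).symm

theorem succ_smul {f : ℕ → 𝕜 → F} (hf : IsTaylorSeq 𝕜 f s) :
    IsTaylorSeq 𝕜 (fun n z => (n + 1 : 𝕜) • f (n + 1) z) s := fun n z hz =>
  ((hf (n + 1) z hz).fun_const_smul (n + 1 : 𝕜)).congr_deriv (by push_cast; rfl)

theorem mul {f g : ℕ → 𝕜 → A} (hf : IsTaylorSeq 𝕜 f s) (hg : IsTaylorSeq 𝕜 g s) :
    IsTaylorSeq 𝕜 (fun n z => ∑ p ∈ antidiagonal n, f p.1 z * g p.2 z) s := by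
  intro n z hz
  refine (HasDerivAt.fun_sum fun p _ => (hf p.1 z hz).mul (hg p.2 z hz)).congr_deriv ?_
  -- In degree `n + 1` the weights `p.1` and `p.2` that differentiation produces add up to `n + 1`.
  have left : ∑ p ∈ antidiagonal (n + 1), (p.1 : 𝕜) • (f p.1 z * g p.2 z) =
      ∑ p ∈ antidiagonal n, (p.1 + 1 : 𝕜) • f (p.1 + 1) z * g p.2 z := by
    simp [Finset.Nat.sum_antidiagonal_succ]
  have right : ∑ p ∈ antidiagonal (n + 1), (p.2 : 𝕜) • (f p.1 z * g p.2 z) =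
      ∑ p ∈ antidiagonal n, f p.1 z * (p.2 + 1 : 𝕜) • g (p.2 + 1) z := by
    simp [Finset.Nat.sum_antidiagonal_succ']
  rw [sum_add_distrib, ← left, ← right, ← sum_add_distrib, smul_sum]
  refine sum_congr rfl fun p hp => ?_
  rw [← add_smul, ← Nat.cast_add, mem_antidiagonal.1 hp, Nat.cast_succ]

theorem eqOn [CharZero 𝕜] {f g : ℕ → 𝕜 → F} (hs : IsOpen s) (hf : IsTaylorSeq 𝕜 f s)
    (hg : IsTaylorSeq 𝕜 g s) (h : EqOn (f 0) (g 0) s) (n : ℕ) : EqOn (f n) (g n) s := by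
  induction n with
  | zero => exact h
  | succ n ih =>
    intro z hz
    have hderiv := (hf n z hz).unique
      ((hg n z hz).congr_of_eventuallyEq (ih.eventuallyEq_of_mem (hs.mem_nhds hz)))
    exact smul_right_injective F (Nat.cast_add_one_ne_zero n) hderiv

theorem succ_smul_eq_sum_antidiagonal [CharZero 𝕜] {f g : ℕ → 𝕜 → A} (hs : IsOpen s)
    (hf : IsTaylorSeq 𝕜 f s) (hg : IsTaylorSeq 𝕜 g s) (h : ∀ z ∈ s, f 1 z = f 0 z * g 0 z)
    (n : ℕ) {z : 𝕜} (hz : z ∈ s) :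
    (n + 1 : 𝕜) • f (n + 1) z = ∑ p ∈ antidiagonal n, f p.1 z * g p.2 z :=
  eqOn hs hf.succ_smul (hf.mul hg) (fun z hz => by simpa using h z hz) n hz

theorem tsum [IsRCLikeNormedField 𝕜] [CompleteSpace F] {f : ι → ℕ → 𝕜 → F} {u : ℕ → ι → ℝ}
    {z₀ : 𝕜} (hs : IsOpen s) (hs' : IsPreconnected s) (hf : ∀ i, IsTaylorSeq 𝕜 (f i) s)
    (hu : ∀ n, Summable (u n)) (hfu : ∀ n i, ∀ z ∈ s, ‖f i (n + 1) z‖ ≤ u n i) (hz₀ : z₀ ∈ s)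
    (h₀ : Summable fun i => f i 0 z₀) : IsTaylorSeq 𝕜 (fun n z => ∑' i, f i n z) s := by
  have summable : ∀ n, Summable fun i => f i n z₀
    | 0 => h₀
    | n + 1 => (hu n).of_norm_bounded fun i => hfu n i z₀ hz₀
  intro n z hz
  refine (hasDerivAt_tsum_of_isPreconnected ((hu n).mul_left ‖(n + 1 : 𝕜)‖) hs hs'
    (fun i w hw => hf i n w hw) (fun i w hw => ?_) hz₀ (summable n) hz).congr_deriv ?_
  · rw [norm_smul]
    exact mul_le_mul_of_nonneg_left (hfu n i w hw) (norm_nonneg _)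
  · exact tsum_const_smul'' _

end IsTaylorSeq

theorem isTaylorSeq_div_sub_pow (a x : 𝕜) :
    IsTaylorSeq 𝕜 (fun n z => a / (x - z) ^ (n + 1)) {x}ᶜ := by
  intro n z hz
  have hxz : x - z ≠ 0 := sub_ne_zero.2 (Ne.symm hz)
  have hpow := ((hasDerivAt_id z).const_sub x).fun_pow (n + 1)
  refine ((hasDerivAt_const z a).fun_div hpow (pow_ne_zero _ hxz)).congr_deriv ?_
  simp only [id, smul_eq_mul, Nat.add_sub_cancel, Nat.cast_add_one]
  field_simp
  ring

end TaylorSequences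

section PoleSums

variable {z : ℝ}

theorem one_div_pow_le_of_div_four_le {k : ℕ} {x : ℝ} (hx : ((k : ℝ) + 1) / 4 ≤ x) (n : ℕ) :
    1 / x ^ n ≤ 4 ^ n * (1 / (k + 1 : ℝ) ^ n) :=
  calc 1 / x ^ n ≤ 1 / (((k : ℝ) + 1) / 4) ^ n := by gcongr
    _ = 4 ^ n * (1 / (k + 1 : ℝ) ^ n) := by rw [div_pow]; field_simp

theorem div_four_le_add_half_sub (hz : z < 1 / 4) (k : ℕ) :
    ((k : ℝ) + 1) / 4 ≤ k + 1 / 2 - z := by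
  linarith [k.cast_nonneg (α := ℝ)]

theorem div_four_le_add_one_sub (hz : z < 1 / 4) (k : ℕ) :
    ((k : ℝ) + 1) / 4 ≤ k + 1 - z := by
  linarith [div_four_le_add_half_sub hz k]

theorem add_half_sub_pos (hz : z < 1 / 4) (k : ℕ) : 0 < (k : ℝ) + 1 / 2 - z :=
  lt_of_lt_of_le (by positivity) (div_four_le_add_half_sub hz k)

theorem add_one_sub_pos (hz : z < 1 / 4) (k : ℕ) : 0 < (k : ℝ) + 1 - z :=
  lt_of_lt_of_le (by positivity) (div_four_le_add_one_sub hz k)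

/-- The `n`-th Taylor coefficient at `z` of `∑ c k / (k + 1 - z)`, a function with simple poles at
the positive integers. At `z = 0` it is the Dirichlet series `∑ c (k - 1) / k ^ (n + 1)` over
`k ≥ 1`. -/
noncomputable def poleSum (c : ℕ → ℝ) (n : ℕ) (z : ℝ) : ℝ :=
  ∑' k : ℕ, c k / (k + 1 - z) ^ (n + 1)

theorem norm_div_add_one_sub_pow_le (c : ℕ → ℝ) (hz : z < 1 / 4) (n k : ℕ) :
    ‖c k / (k + 1 - z) ^ (n + 1)‖ ≤ 4 ^ (n + 1) * ‖c k / (k + 1)‖ := by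
  have hpos := add_one_sub_pos hz k
  have hk : (1 : ℝ) ≤ k + 1 := by linarith [k.cast_nonneg (α := ℝ)]
  have hpow : 1 / (k + 1 : ℝ) ^ (n + 1) ≤ 1 / (k + 1) :=
    one_div_le_one_div_of_le (by positivity) (le_self_pow₀ hk n.succ_ne_zero)
  calc ‖c k / (k + 1 - z) ^ (n + 1)‖ = |c k| * (1 / (k + 1 - z) ^ (n + 1)) := by
        rw [Real.norm_eq_abs, abs_div, abs_of_pos (pow_pos hpos _), mul_one_div]
    _ ≤ |c k| * (4 ^ (n + 1) * (1 / (k + 1 : ℝ) ^ (n + 1))) := by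
        gcongr; exact one_div_pow_le_of_div_four_le (div_four_le_add_one_sub hz k) _
    _ ≤ |c k| * (4 ^ (n + 1) * (1 / (k + 1))) := by gcongr
    _ = 4 ^ (n + 1) * ‖c k / (k + 1)‖ := by
        rw [Real.norm_eq_abs, abs_div, abs_of_pos (by positivity : (0 : ℝ) < k + 1)]; ring

variable {c : ℕ → ℝ}

theorem hasSum_poleSum (hc : Summable fun k => c k / (k + 1)) (hz : z < 1 / 4) (n : ℕ) :
    HasSum (fun k : ℕ => c k / (k + 1 - z) ^ (n + 1)) (poleSum c n z) :=
  ((hc.norm.mul_left (4 ^ (n + 1))).of_norm_bounded (norm_div_add_one_sub_pow_le c hz n)).hasSum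

theorem isTaylorSeq_poleSum (hc : Summable fun k => c k / (k + 1)) :
    IsTaylorSeq ℝ (poleSum c) (Iio (1 / 4)) :=
  IsTaylorSeq.tsum isOpen_Iio isPreconnected_Iio
    (fun k => (isTaylorSeq_div_sub_pow (c k) (k + 1 : ℝ)).mono
      fun _ hw => (sub_pos.1 (add_one_sub_pos hw k)).ne)
    (fun n => hc.norm.mul_left (4 ^ (n + 2)))
    (fun n k _ hw => norm_div_add_one_sub_pow_le c hw (n + 1) k)
    (mem_Iio.2 (by norm_num : (0 : ℝ) < 1 / 4))
    (hasSum_poleSum hc (by norm_num) 0).summable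

theorem poleSum_nonneg (hc : ∀ k, 0 ≤ c k) (hz : z < 1 / 4) (n : ℕ) : 0 ≤ poleSum c n z :=
  tsum_nonneg fun k => div_nonneg (hc k) (pow_pos (add_one_sub_pos hz k) _).le

theorem neg_mul_poleSum_succ_le (hc : Summable fun k => c k / (k + 1)) (hc' : ∀ k, 0 ≤ c k)
    (hz : z < 1 / 4) (n : ℕ) : -z * poleSum c (n + 1) z ≤ poleSum c n z := by
  refine hasSum_le (fun k => ?_) ((hasSum_poleSum hc hz (n + 1)).mul_left _)
    (hasSum_poleSum hc hz n)
  have hpos := add_one_sub_pos hz k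
  calc -z * (c k / (k + 1 - z) ^ (n + 1 + 1))
      ≤ (k + 1 - z) * (c k / (k + 1 - z) ^ (n + 1 + 1)) := by
        gcongr
        · exact div_nonneg (hc' k) (pow_pos hpos _).le
        · linarith [k.cast_nonneg (α := ℝ)]
    _ = c k / (k + 1 - z) ^ (n + 1) := by rw [pow_succ _ (n + 1)]; field_simp

theorem tendsto_poleSum_atBot (hc : Summable fun k => c k / (k + 1)) (n : ℕ) :
    Tendsto (poleSum c n) atBot (𝓝 0) := by
  have hterm (k : ℕ) : Tendsto (fun z : ℝ => c k / (k + 1 - z) ^ (n + 1)) atBot (𝓝 0) := by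
    have hsub : Tendsto (fun z : ℝ => k + 1 - z) atBot atTop :=
      tendsto_atTop_add_const_left _ _ tendsto_neg_atBot_atTop
    exact ((tendsto_pow_atTop n.succ_ne_zero).comp hsub).const_div_atTop _
  have hbound : ∀ᶠ z : ℝ in atBot, ∀ k : ℕ,
      ‖c k / (k + 1 - z) ^ (n + 1)‖ ≤ 4 ^ (n + 1) * ‖c k / (k + 1)‖ :=
    (eventually_lt_atBot (1 / 4)).mono fun z hz => norm_div_add_one_sub_pow_le c hz n
  rw [← tsum_zero (β := ℕ)]
  exact tendsto_tsum_of_dominated_convergence (hc.norm.mul_left _) hterm hbound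

end PoleSums

section CentralBinomial

/-- The normalised central binomial coefficient `binom(2k, k) / 4 ^ k`, i.e. the coefficient of
`x ^ k` in `(1 - x) ^ (-1 / 2)`. -/
noncomputable def centralBinomRatio (k : ℕ) : ℝ := k.centralBinom / 4 ^ k

theorem centralBinomRatio_zero : centralBinomRatio 0 = 1 := by simp [centralBinomRatio]

theorem centralBinomRatio_pos (k : ℕ) : 0 < centralBinomRatio k :=
  div_pos (Nat.cast_pos.2 k.centralBinom_pos) (by positivity)

theorem succ_mul_centralBinomRatio_succ (k : ℕ) :
    (k + 1) * centralBinomRatio (k + 1) = (k + 1 / 2) * centralBinomRatio k := by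
  have h : ((k : ℝ) + 1) * (k + 1).centralBinom = 2 * (2 * k + 1) * k.centralBinom := by
    exact_mod_cast k.succ_mul_centralBinom_succ
  simp only [centralBinomRatio, pow_succ]
  field_simp
  linear_combination 2 * h

theorem centralBinomRatio_sq_mul_le_one (k : ℕ) : centralBinomRatio k ^ 2 * (2 * k + 1) ≤ 1 := by
  induction k with
  | zero => simp [centralBinomRatio_zero]
  | succ k ih =>
    have hsucc : centralBinomRatio (k + 1) = (k + 1 / 2) * centralBinomRatio k / (k + 1) := by
      rw [← succ_mul_centralBinomRatio_succ]; field_simp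
    have hfactor : ((k : ℝ) + 1 / 2) ^ 2 * (2 * (k + 1) + 1) ≤ (2 * k + 1) * (k + 1) ^ 2 := by
      nlinarith [k.cast_nonneg (α := ℝ)]
    calc centralBinomRatio (k + 1) ^ 2 * (2 * (k + 1 : ℕ) + 1)
        = centralBinomRatio k ^ 2 * (((k : ℝ) + 1 / 2) ^ 2 * (2 * (k + 1) + 1)) / (k + 1) ^ 2 := by
          rw [hsucc, div_pow, mul_pow]; push_cast; ring
      _ ≤ centralBinomRatio k ^ 2 * ((2 * k + 1) * (k + 1) ^ 2) / (k + 1) ^ 2 := by gcongr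
      _ = centralBinomRatio k ^ 2 * (2 * k + 1) := by field_simp
      _ ≤ 1 := ih

theorem tendsto_centralBinomRatio : Tendsto centralBinomRatio atTop (𝓝 0) := by
  have hsq : Tendsto (fun k => centralBinomRatio k ^ 2) atTop (𝓝 0) := by
    refine squeeze_zero (fun k => sq_nonneg _) (fun k => ?_)
      (tendsto_one_div_add_atTop_nhds_zero_nat (𝕜 := ℝ))
    rw [le_div_iff₀ (by positivity)]
    refine le_trans ?_ (centralBinomRatio_sq_mul_le_one k)
    gcongr
    linarith [k.cast_nonneg (α := ℝ)]
  simpa [Real.sqrt_sq (centralBinomRatio_pos _).le] using hsq.sqrt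

theorem centralBinomRatio_succ_div_le (k : ℕ) : centralBinomRatio (k + 1) / (k + 1) ≤
    2 * (centralBinomRatio k - centralBinomRatio (k + 1)) := by
  rw [div_le_iff₀ (by positivity)]
  nlinarith [succ_mul_centralBinomRatio_succ k, centralBinomRatio_pos k,
    centralBinomRatio_pos (k + 1)]

theorem summable_centralBinomRatio_succ_div :
    Summable fun k : ℕ => centralBinomRatio (k + 1) / (k + 1) := by
  refine summable_of_sum_range_le (c := 2)
    (fun k => div_nonneg (centralBinomRatio_pos _).le (by positivity)) fun N => ?_
  calc ∑ k ∈ range N, centralBinomRatio (k + 1) / (k + 1)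
      ≤ ∑ k ∈ range N, 2 * (centralBinomRatio k - centralBinomRatio (k + 1)) :=
        sum_le_sum fun k _ => centralBinomRatio_succ_div_le k
    _ = 2 * (1 - centralBinomRatio N) := by
        rw [← mul_sum, sum_range_sub', centralBinomRatio_zero]
    _ ≤ 2 := by linarith [centralBinomRatio_pos N]

/-- The `n`-th Taylor coefficient at `z` of the generating function
`∑ binom(2k, k) / (4 ^ k (k - z))`, `k ≥ 1`, of the sums `∑ binom(2k, k) / (4 ^ k k ^ (n + 1))`,
which are its values at `z = 0`. -/
noncomputable def centralBinomSum : ℕ → ℝ → ℝ := poleSum fun k => centralBinomRatio (k + 1)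

variable {z : ℝ}

theorem isTaylorSeq_centralBinomSum : IsTaylorSeq ℝ centralBinomSum (Iio (1 / 4)) :=
  isTaylorSeq_poleSum summable_centralBinomRatio_succ_div

theorem centralBinomSum_nonneg (hz : z < 1 / 4) (n : ℕ) : 0 ≤ centralBinomSum n z :=
  poleSum_nonneg (fun _ => (centralBinomRatio_pos _).le) hz n

theorem hasSum_centralBinomSum (hz : z < 1 / 4) (n : ℕ) :
    HasSum (fun k : ℕ => centralBinomRatio (k + 1) / (k + 1 - z) ^ (n + 1))
      (centralBinomSum n z) :=
  hasSum_poleSum summable_centralBinomRatio_succ_div hz n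

theorem hasSum_centralBinomSum_zero (hz : z < 1 / 4) :
    HasSum (fun k : ℕ => centralBinomRatio (k + 1) / (k + 1 - z)) (centralBinomSum 0 z) := by
  simpa only [zero_add, pow_one] using hasSum_centralBinomSum hz 0

theorem tendsto_succ_mul_centralBinomRatio_div (hz : z < 1 / 4) :
    Tendsto (fun k : ℕ => (k + 1) * centralBinomRatio (k + 1) / (k + 1 - z)) atTop (𝓝 0) := by
  have hratio := ((tendsto_add_atTop_iff_nat 1).2 tendsto_centralBinomRatio).const_mul 4
  rw [mul_zero] at hratio
  refine squeeze_zero (fun k => ?_) (fun k => ?_) hratio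
  · have := add_one_sub_pos hz k
    have := centralBinomRatio_pos (k + 1)
    positivity
  · rw [div_le_iff₀ (add_one_sub_pos hz k)]
    nlinarith [div_four_le_add_one_sub hz k, centralBinomRatio_pos (k + 1)]

theorem centralBinomSum_zero_recurrence (hz : z < 1 / 4) :
    z * centralBinomSum 0 z + (1 / 2 - z) * centralBinomSum 0 (z - 1) = 1 / (2 * (1 - z)) := by
  set T : ℕ → ℝ := fun k => (k + 1) * centralBinomRatio (k + 1) / (k + 1 - z) with hT
  have hterm (k : ℕ) : z * (centralBinomRatio (k + 1) / (k + 1 - z)) +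
      (1 / 2 - z) * (centralBinomRatio (k + 1) / (k + 1 - (z - 1))) = T k - T (k + 1) := by
    have hk := add_one_sub_pos hz k
    have hk' : (0 : ℝ) < k + 1 - (z - 1) := by linarith
    have hk'' : ((k + 1 : ℕ) : ℝ) + 1 - z = k + 1 - (z - 1) := by push_cast; ring
    simp only [hT]
    rw [succ_mul_centralBinomRatio_succ (k + 1), hk'']
    push_cast
    field_simp
    ring
  have hsum := (((hasSum_centralBinomSum_zero hz).mul_left z).add
    ((hasSum_centralBinomSum_zero (by linarith : z - 1 < 1 / 4)).mul_left
      (1 / 2 - z))).tendsto_sum_nat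
  simp_rw [hterm, sum_range_sub'] at hsum
  have hT₀ : T 0 = 1 / (2 * (1 - z)) := by
    simp only [hT, succ_mul_centralBinomRatio_succ 0, centralBinomRatio_zero]
    push_cast
    field_simp
    ring
  rw [← hT₀, ← sub_zero (T 0)]
  exact tendsto_nhds_unique hsum ((tendsto_succ_mul_centralBinomRatio_div hz).const_sub (T 0))

end CentralBinomial

section GammaQuotient

/-- The `n`-th Taylor coefficient at `z` of `1 - z ∑ binom(2k, k) / (4 ^ k (k - z))`, `k ≥ 1`.
This function is `Γ(1 - z) Γ(1/2) / Γ(1/2 - z)`. -/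
noncomputable def gammaQuotient : ℕ → ℝ → ℝ
  | 0, z => 1 - z * centralBinomSum 0 z
  | n + 1, z => -(centralBinomSum n z + z * centralBinomSum (n + 1) z)

variable {z : ℝ}

theorem isTaylorSeq_gammaQuotient : IsTaylorSeq ℝ gammaQuotient (Iio (1 / 4))
  | 0, z, hz =>
    (((hasDerivAt_id z).mul (isTaylorSeq_centralBinomSum 0 z hz)).const_sub 1).congr_deriv
      (by simp [gammaQuotient])
  | n + 1, z, hz =>
    ((isTaylorSeq_centralBinomSum n z hz).add
      ((hasDerivAt_id z).mul (isTaylorSeq_centralBinomSum (n + 1) z hz))).neg.congr_deriv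
      (by simp only [gammaQuotient, id_eq, smul_eq_mul, Nat.cast_add_one]; ring)

theorem gammaQuotient_functional_equation (hz : z < 1 / 4) :
    (1 - z) * gammaQuotient 0 z = (1 / 2 - z) * gammaQuotient 0 (z - 1) := by
  have hz' : 1 - z ≠ 0 := by linarith
  have hrec := centralBinomSum_zero_recurrence hz
  rw [eq_div_iff (by simpa using hz')] at hrec
  simp only [gammaQuotient]
  linear_combination -hrec / 2

theorem one_le_gammaQuotient (hz : z ≤ 0) : 1 ≤ gammaQuotient 0 z := by
  have := mul_nonneg (neg_nonneg.2 hz) (centralBinomSum_nonneg (by linarith : z < 1 / 4) 0)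
  simp only [gammaQuotient]
  linarith

theorem gammaQuotient_pos (hz : z < 1 / 4) : 0 < gammaQuotient 0 z := by
  have hshift : 0 < gammaQuotient 0 (z - 1) :=
    zero_lt_one.trans_le (one_le_gammaQuotient (by linarith))
  refine pos_of_mul_pos_right (a := 1 - z) ?_ (by linarith)
  rw [gammaQuotient_functional_equation hz]
  exact mul_pos (by linarith) hshift

theorem logDeriv_gammaQuotient (hz : z < 1 / 4) :
    logDeriv (gammaQuotient 0) z = gammaQuotient 1 z / gammaQuotient 0 z := by
  rw [logDeriv_apply, (isTaylorSeq_gammaQuotient 0 z hz).deriv]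
  simp

theorem norm_logDeriv_gammaQuotient_le (hz : z ≤ 0) :
    ‖logDeriv (gammaQuotient 0) z‖ ≤ centralBinomSum 0 z := by
  have hz' : z < 1 / 4 := by linarith
  have hle : -z * centralBinomSum 1 z ≤ centralBinomSum 0 z :=
    neg_mul_poleSum_succ_le summable_centralBinomRatio_succ_div
      (fun _ => (centralBinomRatio_pos _).le) hz' 0
  have hnonneg := mul_nonneg (neg_nonneg.2 hz) (centralBinomSum_nonneg hz' 1)
  have hderiv : |gammaQuotient 1 z| ≤ centralBinomSum 0 z := by
    simp only [gammaQuotient]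
    rw [abs_neg, abs_le]
    constructor <;> linarith [centralBinomSum_nonneg hz' 0]
  rw [logDeriv_gammaQuotient hz', Real.norm_eq_abs, abs_div, abs_of_pos (gammaQuotient_pos hz')]
  exact (div_le_self (abs_nonneg _) (one_le_gammaQuotient hz)).trans hderiv

theorem tendsto_logDeriv_gammaQuotient_atBot :
    Tendsto (logDeriv (gammaQuotient 0)) atBot (𝓝 0) :=
  squeeze_zero_norm' ((eventually_le_atBot 0).mono fun _ => norm_logDeriv_gammaQuotient_le)
    (tendsto_poleSum_atBot summable_centralBinomRatio_succ_div 0)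

theorem logDeriv_gammaQuotient_sub_shift (hz : z < 1 / 4) :
    logDeriv (gammaQuotient 0) z - logDeriv (gammaQuotient 0) (z - 1) =
      1 / (1 - z) - 1 / (1 / 2 - z) := by
  have hz₁ : z - 1 < 1 / 4 := by linarith
  have hfe : (fun w => (1 - w) * gammaQuotient 0 w) =ᶠ[𝓝 z]
      fun w => (1 / 2 - w) * gammaQuotient 0 (w - 1) := by
    filter_upwards [Iio_mem_nhds hz] with w hw using gammaQuotient_functional_equation hw
  have hlinear (a : ℝ) : logDeriv (fun w => a - w) z = -(1 / (a - z)) := by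
    simp [logDeriv_apply, neg_div]
  have hcomp : logDeriv (fun w => gammaQuotient 0 (w - 1)) z =
      logDeriv (gammaQuotient 0) (z - 1) := by
    simp [logDeriv_apply, deriv_comp_sub_const]
  have h := (logDeriv_congr_nhds hfe).eq_of_nhds
  rw [logDeriv_mul z (by linarith) (gammaQuotient_pos hz).ne' (by fun_prop)
      (isTaylorSeq_gammaQuotient 0 z hz).differentiableAt,
    logDeriv_mul z (by linarith) (gammaQuotient_pos hz₁).ne' (by fun_prop)
      ((isTaylorSeq_gammaQuotient 0 (z - 1) hz₁).comp_sub_const z 1).differentiableAt,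
    hlinear, hlinear, hcomp] at h
  linarith

theorem one_div_add_one_sub_pow_le (hz : z < 1 / 4) (n j : ℕ) :
    1 / ((j : ℝ) + 1 - z) ^ n ≤ 1 / (j + 1 / 2 - z) ^ n := by
  have := add_half_sub_pos hz j
  gcongr
  norm_num

theorem hasSum_logDeriv_gammaQuotient (hz : z < 1 / 4) :
    HasSum (fun j : ℕ => 1 / (j + 1 - z) - 1 / (j + 1 / 2 - z))
      (logDeriv (gammaQuotient 0) z) := by
  set L := logDeriv (gammaQuotient 0)
  have hterm (j : ℕ) : 1 / (j + 1 / 2 - z) - 1 / (j + 1 - z) = L (z - (j + 1 : ℕ)) - L (z - j) := by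
    have h := logDeriv_gammaQuotient_sub_shift (z := z - j) (by linarith [j.cast_nonneg (α := ℝ)])
    rw [← neg_sub (L _), Nat.cast_add_one, ← sub_sub, h, neg_sub]
    congr 2 <;> ring
  have hlim : Tendsto (fun N : ℕ => L (z - N)) atTop (𝓝 0) :=
    tendsto_logDeriv_gammaQuotient_atBot.comp
      (tendsto_atBot_add_const_left _ z (tendsto_neg_atTop_atBot.comp tendsto_natCast_atTop_atTop))
  have hneg : HasSum (fun j : ℕ => 1 / (j + 1 / 2 - z) - 1 / (j + 1 - z)) (-L z) := by
    refine (hasSum_iff_tendsto_nat_of_nonneg (fun j => sub_nonneg.2 ?_) _).2 ?_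
    · simpa only [pow_one] using one_div_add_one_sub_pow_le hz 1 j
    · simp_rw [hterm, sum_range_sub fun j : ℕ => L (z - j)]
      simpa using hlim.sub_const (L z)
  simpa only [neg_sub, neg_neg] using hneg.neg

/-- The `n`-th Taylor coefficient at `z` of `ψ(1/2 - z) - ψ(1 - z)`, where `ψ` is the digamma
function, written as the difference of the two pole expansions of `ψ`. -/
noncomputable def digammaDiff (n : ℕ) (z : ℝ) : ℝ :=
  ∑' j : ℕ, (1 / (j + 1 - z) ^ (n + 1) - 1 / (j + 1 / 2 - z) ^ (n + 1))

theorem norm_digammaDiff_term_le (hz : z < 1 / 4) (n j : ℕ) :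
    ‖1 / ((j : ℝ) + 1 - z) ^ n - 1 / (j + 1 / 2 - z) ^ n‖ ≤ 4 ^ n * (1 / (j + 1 : ℝ) ^ n) := by
  have := add_one_sub_pos hz j
  rw [Real.norm_eq_abs, abs_sub_comm,
    abs_of_nonneg (sub_nonneg.2 (one_div_add_one_sub_pow_le hz n j))]
  exact (sub_le_self _ (by positivity)).trans
    (one_div_pow_le_of_div_four_le (div_four_le_add_half_sub hz j) n)

theorem isTaylorSeq_digammaDiff : IsTaylorSeq ℝ digammaDiff (Iio (1 / 4)) := by
  have hsummable (n : ℕ) :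
      Summable fun j : ℕ => (4 : ℝ) ^ (n + 2) * (1 / (j + 1 : ℝ) ^ (n + 2)) := by
    have h := (summable_nat_add_iff 1).2 (Real.summable_one_div_nat_pow.2 (by omega : 1 < n + 2))
    exact (by exact_mod_cast h : Summable fun j : ℕ => 1 / (j + 1 : ℝ) ^ (n + 2)).mul_left _
  refine IsTaylorSeq.tsum (z₀ := 0) isOpen_Iio isPreconnected_Iio (fun j => ?_) hsummable
    (fun n j w hw => norm_digammaDiff_term_le hw (n + 2) j) (mem_Iio.2 (by norm_num)) ?_
  · exact ((isTaylorSeq_div_sub_pow 1 (j + 1 : ℝ)).mono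
        fun w hw => (sub_pos.1 (add_one_sub_pos hw j)).ne).sub
      ((isTaylorSeq_div_sub_pow 1 (j + 1 / 2 : ℝ)).mono
        fun w hw => (sub_pos.1 (add_half_sub_pos hw j)).ne)
  · simpa only [zero_add, pow_one] using
      (hasSum_logDeriv_gammaQuotient (by norm_num : (0 : ℝ) < 1 / 4)).summable

theorem gammaQuotient_one_eq (hz : z < 1 / 4) :
    gammaQuotient 1 z = gammaQuotient 0 z * digammaDiff 0 z := by
  have h : digammaDiff 0 z = logDeriv (gammaQuotient 0) z := by
    simpa only [digammaDiff, zero_add, pow_one] using (hasSum_logDeriv_gammaQuotient hz).tsum_eq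
  rw [h, logDeriv_gammaQuotient hz, mul_div_cancel₀ _ (gammaQuotient_pos hz).ne']

theorem succ_mul_gammaQuotient_succ (n : ℕ) (hz : z < 1 / 4) :
    (n + 1) * gammaQuotient (n + 1) z =
      ∑ p ∈ antidiagonal n, gammaQuotient p.1 z * digammaDiff p.2 z :=
  isTaylorSeq_gammaQuotient.succ_smul_eq_sum_antidiagonal isOpen_Iio isTaylorSeq_digammaDiff
    (fun _ => gammaQuotient_one_eq) n hz

end GammaQuotient

section SpecialValues

theorem tendsto_harmonic_two_mul_sub_harmonic :
    Tendsto (fun N : ℕ => (harmonic (2 * N) - harmonic N : ℝ)) atTop (𝓝 (Real.log 2)) := by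
  have hγ := Real.tendsto_harmonic_sub_log
  have hγ₂ := hγ.comp (tendsto_id.const_mul_atTop' (two_pos : 0 < 2))
  have h := (hγ₂.sub hγ).add_const (Real.log 2)
  rw [sub_self, zero_add] at h
  refine h.congr' ?_
  filter_upwards [eventually_ne_atTop 0] with N hN
  simp only [Function.comp, id, Nat.cast_mul, Nat.cast_ofNat]
  rw [Real.log_mul two_ne_zero (Nat.cast_ne_zero.2 hN)]
  ring

theorem sum_range_one_div_add_one_sub_one_div_add_half (N : ℕ) :
    ∑ j ∈ range N, (1 / ((j : ℝ) + 1) - 1 / (j + 1 / 2)) =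
      -2 * (harmonic (2 * N) - harmonic N) := by
  induction N with
  | zero => simp
  | succ N ih =>
    rw [sum_range_succ, ih, Nat.mul_succ, harmonic_succ, harmonic_succ, harmonic_succ]
    push_cast
    field_simp
    ring

theorem digammaDiff_zero_zero : digammaDiff 0 0 = -2 * Real.log 2 := by
  have hsum : HasSum (fun j : ℕ => 1 / ((j : ℝ) + 1) - 1 / (j + 1 / 2)) (digammaDiff 0 0) := by
    simpa only [digammaDiff, sub_zero, zero_add, pow_one] using
      (hasSum_logDeriv_gammaQuotient (by norm_num : (0 : ℝ) < 1 / 4)).summable.hasSum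
  refine tendsto_nhds_unique hsum.tendsto_sum_nat ?_
  simp_rw [sum_range_one_div_add_one_sub_one_div_add_half]
  exact tendsto_harmonic_two_mul_sub_harmonic.const_mul (-2)

theorem hasSum_riemannZeta_nat {k : ℕ} (hk : 1 < k) :
    HasSum (fun j : ℕ => 1 / (j + 1 : ℂ) ^ k) (riemannZeta k) := by
  have hsummable : Summable fun j : ℕ => 1 / (j : ℂ) ^ k := by
    simpa using Complex.summable_ofReal.2 (Real.summable_one_div_nat_pow.2 hk)
  have h := (hasSum_nat_add_iff' 1).2 hsummable.hasSum
  rw [← zeta_nat_eq_tsum_of_gt_one hk] at h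
  simpa [(zero_lt_one.trans hk).ne'] using h

theorem hasSum_one_div_add_half_pow {k : ℕ} (hk : 1 < k) :
    HasSum (fun j : ℕ => 1 / (j + 1 / 2 : ℂ) ^ k) ((2 ^ k - 1) * riemannZeta k) := by
  set f : ℕ → ℂ := fun j => 1 / (j + 1 : ℂ) ^ k with hf
  have hζ : HasSum f (riemannZeta k) := hasSum_riemannZeta_nat hk
  have hodd : HasSum (fun j => f (2 * j + 1)) (1 / 2 ^ k * riemannZeta k) := by
    refine (hζ.mul_left (1 / 2 ^ k)).congr_fun fun j => ?_
    simp only [hf]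
    rw [one_div_mul_one_div, ← mul_pow]
    push_cast
    ring_nf
  have heven : Summable fun j => f (2 * j) :=
    hζ.summable.comp_injective (mul_right_injective₀ two_ne_zero)
  have hadd := (heven.hasSum.even_add_odd hodd).unique hζ
  have hvalue : (2 ^ k - 1) * riemannZeta k = 2 ^ k * ∑' j, f (2 * j) := by
    rw [eq_sub_of_add_eq hadd]
    field_simp
  rw [hvalue]
  refine (heven.hasSum.mul_left (2 ^ k)).congr_fun fun j => ?_
  have hj : (j + 1 / 2 : ℂ) = ((2 * j : ℕ) + 1) / 2 := by push_cast; ring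
  simp only [hf]
  rw [hj, div_pow, one_div_div, mul_one_div]

theorem digammaDiff_succ_zero (n : ℕ) :
    (digammaDiff (n + 1) 0 : ℂ) = (2 - 2 ^ (n + 2)) * riemannZeta (n + 2) := by
  have hn : 1 < n + 2 := by omega
  have h := ((hasSum_riemannZeta_nat hn).sub (hasSum_one_div_add_half_pow hn)).tsum_eq
  rw [digammaDiff, Complex.ofReal_tsum]
  push_cast at h ⊢
  simp only [sub_zero]
  rw [h]
  ring

theorem centralBinomSum_zero_zero : centralBinomSum 0 0 = 2 * Real.log 2 := by
  have h := succ_mul_gammaQuotient_succ 0 (by norm_num : (0 : ℝ) < 1 / 4)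
  simp only [Finset.Nat.antidiagonal_zero, sum_singleton, gammaQuotient, digammaDiff_zero_zero,
    Nat.cast_zero] at h
  linarith

theorem succ_mul_centralBinomSum_succ (n : ℕ) :
    (n + 2) * centralBinomSum (n + 1) 0 = -digammaDiff (n + 1) 0 +
      ∑ p ∈ antidiagonal n, centralBinomSum p.1 0 * digammaDiff p.2 0 := by
  have h := succ_mul_gammaQuotient_succ (n + 1) (by norm_num : (0 : ℝ) < 1 / 4)
  rw [Finset.Nat.sum_antidiagonal_succ] at h
  simp only [gammaQuotient, Nat.cast_add_one, zero_mul, add_zero, sub_zero, one_mul, neg_mul,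
    sum_neg_distrib] at h
  linarith

theorem ofReal_succ_mul_centralBinomSum_succ (n : ℕ) :
    (n + 2) * (centralBinomSum (n + 1) 0 : ℂ) = -digammaDiff (n + 1) 0 +
      ∑ p ∈ antidiagonal n, (centralBinomSum p.1 0 : ℂ) * digammaDiff p.2 0 := by
  exact_mod_cast congrArg Complex.ofReal (succ_mul_centralBinomSum_succ n)

theorem digammaDiff_one_zero : (digammaDiff 1 0 : ℂ) = -2 * riemannZeta 2 :=
  (digammaDiff_succ_zero 0).trans (by norm_num)

theorem digammaDiff_two_zero : (digammaDiff 2 0 : ℂ) = -6 * riemannZeta 3 :=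
  (digammaDiff_succ_zero 1).trans (by norm_num)

theorem digammaDiff_three_zero : (digammaDiff 3 0 : ℂ) = -14 * riemannZeta 4 :=
  (digammaDiff_succ_zero 2).trans (by norm_num)

theorem riemannZeta_two_sq : riemannZeta 2 ^ 2 = 5 / 2 * riemannZeta 4 := by
  rw [riemannZeta_two, riemannZeta_four]
  ring

theorem centralBinomSum_one_zero :
    (centralBinomSum 1 0 : ℂ) = riemannZeta 2 - 2 * (Real.log 2 : ℂ) ^ 2 := by
  have h := ofReal_succ_mul_centralBinomSum_succ 0
  simp only [Finset.Nat.antidiagonal_zero, sum_singleton, zero_add, digammaDiff_one_zero,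
    centralBinomSum_zero_zero, digammaDiff_zero_zero] at h
  push_cast at h
  linear_combination h / 2

theorem centralBinomSum_two_zero :
    (centralBinomSum 2 0 : ℂ) = 2 * riemannZeta 3 - 2 * (Real.log 2 : ℂ) * riemannZeta 2
      + 4 / 3 * (Real.log 2 : ℂ) ^ 3 := by
  have h := ofReal_succ_mul_centralBinomSum_succ 1
  simp only [Finset.Nat.sum_antidiagonal_eq_sum_range_succ_mk, sum_range_succ, range_zero,
    sum_empty, Nat.reduceAdd, Nat.reduceSub, digammaDiff_two_zero,
    digammaDiff_one_zero, centralBinomSum_one_zero, centralBinomSum_zero_zero,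
    digammaDiff_zero_zero] at h
  push_cast at h
  linear_combination h / 3

theorem centralBinomSum_three_zero :
    (centralBinomSum 3 0 : ℂ) = 9 / 4 * riemannZeta 4 - 4 * (Real.log 2 : ℂ) * riemannZeta 3
      + 2 * (Real.log 2 : ℂ) ^ 2 * riemannZeta 2 - 2 / 3 * (Real.log 2 : ℂ) ^ 4 := by
  have h := ofReal_succ_mul_centralBinomSum_succ 2
  simp only [Finset.Nat.sum_antidiagonal_eq_sum_range_succ_mk, sum_range_succ, range_zero,
    sum_empty, Nat.reduceAdd, Nat.reduceSub, digammaDiff_three_zero,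
    digammaDiff_two_zero, digammaDiff_one_zero, centralBinomSum_two_zero, centralBinomSum_one_zero,
    centralBinomSum_zero_zero, digammaDiff_zero_zero] at h
  push_cast at h
  linear_combination h / 4 - riemannZeta_two_sq / 2

theorem hasSum_one_div_pow_mul_choose_div_four_pow (n : ℕ) :
    HasSum (fun k : ℕ => 1 / ((k + 1 : ℕ) : ℂ) ^ (n + 1) * (Nat.choose (2 * (k + 1)) (k + 1) : ℂ)
      * (1 / 4 ^ (k + 1))) (centralBinomSum n 0 : ℂ) := by
  have h := Complex.hasSum_ofReal.2 (hasSum_centralBinomSum (by norm_num : (0 : ℝ) < 1 / 4) n)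
  refine h.congr_fun fun k => ?_
  rw [centralBinomRatio, Nat.centralBinom_eq_two_mul_choose, sub_zero]
  push_cast
  ring

end SpecialValues

theorem mainTheorem8 :
    HasSum
      (fun k : ℕ => 1 / ((k + 1 : ℕ) : ℂ) ^ 3 * (Nat.choose (2 * (k + 1)) (k + 1) : ℂ)
        * (1 / 4 ^ (k + 1)))
      (2 * riemannZeta 3 - 2 * (Real.log 2 : ℂ) * riemannZeta 2
        + 4 / 3 * (Real.log 2 : ℂ) ^ 3) ∧
    HasSum
      (fun k : ℕ => 1 / ((k + 1 : ℕ) : ℂ) ^ 4 * (Nat.choose (2 * (k + 1)) (k + 1) : ℂ)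
        * (1 / 4 ^ (k + 1)))
      (9 / 4 * riemannZeta 4 - 4 * (Real.log 2 : ℂ) * riemannZeta 3
        + 2 * (Real.log 2 : ℂ) ^ 2 * riemannZeta 2
        - 2 / 3 * (Real.log 2 : ℂ) ^ 4) :=
  ⟨centralBinomSum_two_zero ▸ hasSum_one_div_pow_mul_choose_div_four_pow 2,
    centralBinomSum_three_zero ▸ hasSum_one_div_pow_mul_choose_div_four_pow 3⟩
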